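/- Let $\mathcal C$ be a braided monoidal category with tensor product $\otimes$, unit object $K$ and braiding $c$, which admits equalizers and coequalizers (associativity and unit isomorphisms are suppressed from the notation, and an object also denotes its identity morphism). Let $H$ be an object of $\mathcal C$ with a monoid structure $(H,\eta,\mu)$ and a comonoid structure $(H,\varepsilon,\delta)$ such that (b1) $\delta\circ\mu=(\mu\otimes\mu)\circ(H\otimes c_{H,H}\otimes H)\circ(\delta\otimes\delta)$; (b2) $\varepsilon\circ\mu\circ(\mu\otimes H)=((\varepsilon\circ\mu)\otimes(\varepsilon\circ\mu))\circ(H\otimes\delta\otimes H)=((\varepsilon\circ\mu)\otimes(\varepsilon\circ\mu))\circ(H\otimes(c_{H,H}^{-1}\circ\delta)\otimes H)$; (b3) $(\delta\otimes H)\circ\delta\circ\eta=(H\otimes\mu\otimes H)\circ((\delta\circ\eta)\otimes(\delta\circ\eta))=(H\otimes(\mu\circ c_{H,H}^{-1})\otimes H)\circ((\delta\circ\eta)\otimes(\delta\circ\eta))$. Put $$\Pi^L=((\varepsilon\circ\mu)\otimes H)\circ(H\otimes c_{H,H})\circ((\delta\circ\eta)\otimes H),\qquad \Pi^R=(H\otimes(\varepsilon\circ\mu))\circ(c_{H,H}\otimes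 H)\circ(H\otimes(\delta\circ\eta)),$$ and write $f*g=\mu\circ(f\otimes g)\circ\delta$ for $f,g:H\to H$. One says that $H$ is a weak Hopf algebra if, in addition to (b1)–(b3), there is a morphism $\lambda:H\to H$ with $$H*\lambda=\Pi^L,\qquad \lambda*H=\Pi^R,\qquad \lambda*\Pi^L=\Pi^R*\lambda=\lambda,$$ $$\mu\circ(\lambda\otimes\mu)\circ(\delta\otimes H)=\mu\circ(\Pi^R\otimes H),\qquad \mu\circ(H\otimes\mu)\circ(H\otimes\lambda\otimes H)\circ(\delta\otimes H)=\mu\circ(\Pi^L\otimes H),$$ $$\mu\circ(\mu\otimes\lambda)\circ(H\otimes\delta)=\mu\circ(H\otimes\Pi^L),\qquad \mu\circ(\mu\otimes H)\circ(H\otimes\lambda\otimes H)\circ(H\otimes\delta)=\mu\circ(H\otimes\Pi^R)$$ (the last four equalities follow from the first ones by associativity). For $\sigma\in\{L,R\}$ define endomorphisms of $H\otimes H$ by $$\Omega_\sigma^1=(\mu\otimes H)\circ(H\otimes\Pi^\sigma\otimes H)\circ(H\otimes\delta),\qquad \Omega_\sigma^2=(H\otimes\mu)\circ(H\otimes\Pi^\sigma\otimes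 H)\circ(\delta\otimes H),$$ and let $\beta=(\mu\otimes H)\circ(H\otimes\delta)$ and $\gamma=(H\otimes\mu)\circ(\delta\otimes H)$ be the right and left Galois morphisms. Then the four morphisms $\Omega_\sigma^\alpha$ ($\sigma\in\{L,R\}$, $\alpha\in\{1,2\}$) are split idempotents: there are objects $H\times_\sigma^\alpha H$ and morphisms $q_\sigma^\alpha:H\otimes H\to H\times_\sigma^\alpha H$, $j_\sigma^\alpha:H\times_\sigma^\alpha H\to H\otimes H$ with $j_\sigma^\alpha\circ q_\sigma^\alpha=\Omega_\sigma^\alpha$ and $q_\sigma^\alpha\circ j_\sigma^\alpha=id$. For every choice of such splittings, the following assertions are equivalent: (i) $H$ is a weak Hopf algebra; (ii) the morphism $h=q_L^2\circ\gamma\circ j_R^2:H\times_R^2H\to H\times_L^2H$ is an isomorphism; (iii) the morphism $s=q_R^1\circ\beta\circ j_L^1:H\times_L^1H\to H\times_R^1H$ is an isomorphism. -/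

import Mathlib

open CategoryTheory MonoidalCategory
open scoped MonObj ComonObj

universe v u

namespace WeakHopf

section

/-- A splitting of an endomorphism `e`: a factorization `e = j ∘ q` with `q ∘ j = id`. -/
structure IdemSplitting {C : Type u} [Category.{v} C] {X : C} (e : X ⟶ X) where
  /-- the image object -/
  obj : C
  /-- the projection onto the image -/
  q : X ⟶ obj
  /-- the inclusion of the image -/
  j : obj ⟶ X
  q_j : q ≫ j = e
  j_q : j ≫ q = 𝟙 obj

variable {C : Type u} [Category.{v} C] [MonoidalCategory C] [BraidedCategory C]
variable (H : C) [MonObj H] [ComonObj H]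

/-- The compatibility conditions between the product and the coproduct of an object which is
both a monoid and a comonoid.  The two equalities
`ε ∘ μ ∘ (μ ⊗ H) = ε ∘ μ ∘ (H ⊗ μ)` and `(δ ⊗ H) ∘ δ ∘ η = (H ⊗ δ) ∘ δ ∘ η`
are not listed, because they are instances of associativity and of coassociativity. -/
structure IsWeakBimonoid : Prop where
  /-- `δ ∘ μ = (μ ⊗ μ) ∘ (H ⊗ c ⊗ H) ∘ (δ ⊗ δ)` -/
  mul_comul : μ[H] ≫ Δ[H] = (Δ[H] ⊗ₘ Δ[H]) ≫ tensorμ H H H H ≫ (μ[H] ⊗ₘ μ[H])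
  /-- `ε ∘ μ ∘ (μ ⊗ H) = ((ε ∘ μ) ⊗ (ε ∘ μ)) ∘ (H ⊗ δ ⊗ H)` -/
  mul_counit : μ[H] ▷ H ≫ μ[H] ≫ ε[H] =
    (H ◁ Δ[H]) ▷ H ≫ (α_ H H H).inv ▷ H ≫ (α_ (H ⊗ H) H H).hom ≫
      ((μ[H] ≫ ε[H]) ⊗ₘ (μ[H] ≫ ε[H])) ≫ (λ_ (𝟙_ C)).hom
  /-- `ε ∘ μ ∘ (μ ⊗ H) = ((ε ∘ μ) ⊗ (ε ∘ μ)) ∘ (H ⊗ (c⁻¹ ∘ δ) ⊗ H)` -/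
  mul_counit_braid : μ[H] ▷ H ≫ μ[H] ≫ ε[H] =
    (H ◁ (Δ[H] ≫ (β_ H H).inv)) ▷ H ≫ (α_ H H H).inv ▷ H ≫ (α_ (H ⊗ H) H H).hom ≫
      ((μ[H] ≫ ε[H]) ⊗ₘ (μ[H] ≫ ε[H])) ≫ (λ_ (𝟙_ C)).hom
  /-- `(δ ⊗ H) ∘ δ ∘ η = (H ⊗ μ ⊗ H) ∘ ((δ ∘ η) ⊗ (δ ∘ η))` -/
  one_comul : η[H] ≫ Δ[H] ≫ Δ[H] ▷ H =
    (λ_ (𝟙_ C)).inv ≫ ((η[H] ≫ Δ[H]) ⊗ₘ (η[H] ≫ Δ[H])) ≫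
      (α_ (H ⊗ H) H H).inv ≫ (α_ H H H).hom ▷ H ≫ (H ◁ μ[H]) ▷ H
  /-- `(δ ⊗ H) ∘ δ ∘ η = (H ⊗ (μ ∘ c⁻¹) ⊗ H) ∘ ((δ ∘ η) ⊗ (δ ∘ η))` -/
  one_comul_braid : η[H] ≫ Δ[H] ≫ Δ[H] ▷ H =
    (λ_ (𝟙_ C)).inv ≫ ((η[H] ≫ Δ[H]) ⊗ₘ (η[H] ≫ Δ[H])) ≫
      (α_ (H ⊗ H) H H).inv ≫ (α_ H H H).hom ▷ H ≫ (H ◁ ((β_ H H).inv ≫ μ[H])) ▷ H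

/-- The target morphism `Π^L = ((ε ∘ μ) ⊗ H) ∘ (H ⊗ c) ∘ ((δ ∘ η) ⊗ H)`. -/
def piL : H ⟶ H :=
  (λ_ H).inv ≫ (η[H] ≫ Δ[H]) ▷ H ≫ (α_ H H H).hom ≫ H ◁ (β_ H H).hom ≫
    (α_ H H H).inv ≫ (μ[H] ≫ ε[H]) ▷ H ≫ (λ_ H).hom

/-- The source morphism `Π^R = (H ⊗ (ε ∘ μ)) ∘ (c ⊗ H) ∘ (H ⊗ (δ ∘ η))`. -/
def piR : H ⟶ H :=
  (ρ_ H).inv ≫ H ◁ (η[H] ≫ Δ[H]) ≫ (α_ H H H).inv ≫ (β_ H H).hom ▷ H ≫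
    (α_ H H H).hom ≫ H ◁ (μ[H] ≫ ε[H]) ≫ (ρ_ H).hom

variable {H} in
/-- The convolution product `f * g = μ ∘ (f ⊗ g) ∘ δ`. -/
def conv (f g : H ⟶ H) : H ⟶ H := Δ[H] ≫ (f ⊗ₘ g) ≫ μ[H]

/-- The axioms for an antipode. -/
structure IsAntipode (s : H ⟶ H) : Prop where
  /-- `id * s = Π^L` -/
  id_conv : conv (𝟙 H) s = piL H
  /-- `s * id = Π^R` -/
  conv_id : conv s (𝟙 H) = piR H
  /-- `s * Π^L = s` -/
  conv_piL : conv s (piL H) = s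
  /-- `Π^R * s = s` -/
  piR_conv : conv (piR H) s = s
  /-- `μ ∘ (s ⊗ μ) ∘ (δ ⊗ H) = μ ∘ (Π^R ⊗ H)` -/
  left_piR : Δ[H] ▷ H ≫ (α_ H H H).hom ≫ (s ⊗ₘ μ[H]) ≫ μ[H] = piR H ▷ H ≫ μ[H]
  /-- `μ ∘ (H ⊗ μ) ∘ (H ⊗ s ⊗ H) ∘ (δ ⊗ H) = μ ∘ (Π^L ⊗ H)` -/
  left_piL : Δ[H] ▷ H ≫ (α_ H H H).hom ≫ H ◁ (s ▷ H) ≫ H ◁ μ[H] ≫ μ[H] = piL H ▷ H ≫ μ[H]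
  /-- `μ ∘ (μ ⊗ s) ∘ (H ⊗ δ) = μ ∘ (H ⊗ Π^L)` -/
  right_piL : H ◁ Δ[H] ≫ (α_ H H H).inv ≫ (μ[H] ⊗ₘ s) ≫ μ[H] = H ◁ piL H ≫ μ[H]
  /-- `μ ∘ (μ ⊗ H) ∘ (H ⊗ s ⊗ H) ∘ (H ⊗ δ) = μ ∘ (H ⊗ Π^R)` -/
  right_piR : H ◁ Δ[H] ≫ (α_ H H H).inv ≫ (H ◁ s) ▷ H ≫ μ[H] ▷ H ≫ μ[H] = H ◁ piR H ≫ μ[H]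

/-- A weak Hopf algebra in a braided category. -/
structure IsWeakHopfAlgebra : Prop where
  isWeakBimonoid : IsWeakBimonoid H
  exists_antipode : ∃ s : H ⟶ H, IsAntipode H s

/-- `Ω_L^1 = (μ ⊗ H) ∘ (H ⊗ Π^L ⊗ H) ∘ (H ⊗ δ)` -/
def omegaL1 : H ⊗ H ⟶ H ⊗ H :=
  H ◁ Δ[H] ≫ (α_ H H H).inv ≫ (H ◁ piL H) ▷ H ≫ μ[H] ▷ H

/-- `Ω_R^1 = (μ ⊗ H) ∘ (H ⊗ Π^R ⊗ H) ∘ (H ⊗ δ)` -/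
def omegaR1 : H ⊗ H ⟶ H ⊗ H :=
  H ◁ Δ[H] ≫ (α_ H H H).inv ≫ (H ◁ piR H) ▷ H ≫ μ[H] ▷ H

/-- `Ω_L^2 = (H ⊗ μ) ∘ (H ⊗ Π^L ⊗ H) ∘ (δ ⊗ H)` -/
def omegaL2 : H ⊗ H ⟶ H ⊗ H :=
  Δ[H] ▷ H ≫ (α_ H H H).hom ≫ H ◁ (piL H ▷ H) ≫ H ◁ μ[H]

/-- `Ω_R^2 = (H ⊗ μ) ∘ (H ⊗ Π^R ⊗ H) ∘ (δ ⊗ H)` -/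
def omegaR2 : H ⊗ H ⟶ H ⊗ H :=
  Δ[H] ▷ H ≫ (α_ H H H).hom ≫ H ◁ (piR H ▷ H) ≫ H ◁ μ[H]

/-- The right Galois morphism `β = (μ ⊗ H) ∘ (H ⊗ δ)`. -/
def galoisRight : H ⊗ H ⟶ H ⊗ H :=
  H ◁ Δ[H] ≫ (α_ H H H).inv ≫ μ[H] ▷ H

/-- The left Galois morphism `γ = (H ⊗ μ) ∘ (δ ⊗ H)`. -/
def galoisLeft : H ⊗ H ⟶ H ⊗ H :=
  Δ[H] ▷ H ≫ (α_ H H H).hom ≫ H ◁ μ[H]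

variable {H}

/-- The morphism `h = q_L^2 ∘ γ ∘ j_R^2` between the images of `Ω_R^2` and `Ω_L^2`. -/
def hMor (R2 : IdemSplitting (omegaR2 H)) (L2 : IdemSplitting (omegaL2 H)) : R2.obj ⟶ L2.obj :=
  R2.j ≫ galoisLeft H ≫ L2.q

/-- The morphism `s = q_R^1 ∘ β ∘ j_L^1` between the images of `Ω_L^1` and `Ω_R^1`. -/
def sMor (L1 : IdemSplitting (omegaL1 H)) (R1 : IdemSplitting (omegaR1 H)) : L1.obj ⟶ R1.obj :=
  L1.j ≫ galoisRight H ≫ R1.q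

end

end WeakHopf

/-!
Call a morphism `f` of monoids semilinear along `φ` if `f(xy) = f(x)φ(y)`; such an `f` is determined
by `f(1)` and `φ`. The endomorphisms of `H ⊗ H` which are left colinear and right linear over `H`
are exactly the morphisms `x ⊗ y ↦ x₁ ⊗ f(x₂)y` with `f : H ⟶ H`, and composing them amounts to
convolving the morphisms `f` in the reversed order. Here `γ` corresponds to the identity and
`Ω_σ^2` to `Π^σ`.

Left multiplication by `δ(1)` in the monoid `H ⊗ H` is right linear, and `δ` is semilinear along
itself; comparing values at `1` shows that this left multiplication is idempotent, fixes the image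
of `δ` and, by the braided half of (b3), is left colinear. So it is `Ω_L^2`, whence
`Π^L * Π^L = Π^L` and `Π^L * H = H`. The mirror images of these statements are the same statements
for `H` in the category with the reversed tensor product.

Consequently `h` is an isomorphism if and only if `γ` has a generalized inverse relative to the
idempotents `Ω_R^2` and `Ω_L^2`. Such an inverse is again left colinear and right linear, so it is
of the form `x ⊗ y ↦ x₁ ⊗ λ(x₂)y`, and the equations it satisfies say that `λ` is an antipode.
Reversing the tensor product turns `h` into `s`.
-/

namespace WeakHopf

section Idempotents

variable {C : Type u} [Category.{v} C]

theorem IdemSplitting.nonempty_of_idem [IsIdempotentComplete C] {X : C} {e : X ⟶ X}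
    (he : e ≫ e = e) : Nonempty (IdemSplitting e) :=
  let ⟨Y, j, q, j_q, q_j⟩ := IsIdempotentComplete.idempotents_split X e he
  ⟨⟨Y, q, j, q_j, j_q⟩⟩

theorem IdemSplitting.comp_q {X : C} {e : X ⟶ X} (S : IdemSplitting e) : e ≫ S.q = S.q := by
  simpa [S.j_q] using congrArg (· ≫ S.q) S.q_j.symm

theorem IdemSplitting.j_comp {X : C} {e : X ⟶ X} (S : IdemSplitting e) : S.j ≫ e = S.j := by
  simpa [reassoc_of% S.j_q] using congrArg (S.j ≫ ·) S.q_j.symm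

/-- `b'` is a generalized inverse of `b` relative to `e₁` and `e₂`: when `e₁` and `e₂` are
idempotent, it represents an inverse of `b` between their images. -/
structure IsGenInverse {X Y : C} (e₁ : X ⟶ X) (e₂ : Y ⟶ Y) (b : X ⟶ Y) (b' : Y ⟶ X) : Prop where
  comp_inv : b ≫ b' = e₁
  inv_comp : b' ≫ b = e₂
  idem_comp : e₂ ≫ b' = b'
  comp_idem : b' ≫ e₁ = b'

theorem isIso_iff_exists_isGenInverse {X Y : C} {e₁ : X ⟶ X} {e₂ : Y ⟶ Y} {b : X ⟶ Y}
    (S₁ : IdemSplitting e₁) (S₂ : IdemSplitting e₂) (h₁ : e₁ ≫ b = b) (h₂ : b ≫ e₂ = b) :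
    IsIso (S₁.j ≫ b ≫ S₂.q) ↔ ∃ b', IsGenInverse e₁ e₂ b b' := by
  constructor
  · intro _
    set s := S₁.j ≫ b ≫ S₂.q with hs
    have hb : b = S₁.q ≫ s ≫ S₂.j := by
      simp only [hs, Category.assoc, S₂.q_j, reassoc_of% S₁.q_j, h₂, h₁]
    refine ⟨S₂.q ≫ inv s ≫ S₁.j, ?_, ?_, ?_, ?_⟩
    · simp [hb, reassoc_of% S₂.j_q, S₁.q_j]
    · simp [hb, reassoc_of% S₁.j_q, S₂.q_j]
    · rw [reassoc_of% S₂.comp_q]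
    · simp only [Category.assoc, S₁.j_comp]
  · rintro ⟨b', hb⟩
    refine ⟨S₂.j ≫ b' ≫ S₁.q, ?_, ?_⟩
    · simp only [Category.assoc, reassoc_of% S₂.q_j]
      rw [reassoc_of% hb.idem_comp, reassoc_of% hb.comp_inv, S₁.comp_q, S₁.j_q]
    · simp only [Category.assoc, reassoc_of% S₁.q_j]
      rw [reassoc_of% h₁, reassoc_of% hb.inv_comp, S₂.comp_q, S₂.j_q]

theorem IsGenInverse.naturality {D : Type*} [Category* D] (F G : C ⥤ D) {X Y : C}
    {e₁ : X ⟶ X} {e₂ : Y ⟶ Y} {b : X ⟶ Y} {b' : Y ⟶ X} (hb : IsGenInverse e₁ e₂ b b')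
    {x : F.obj X ⟶ G.obj X} {y : F.obj Y ⟶ G.obj Y} (h : F.map b ≫ y = x ≫ G.map b)
    (h₁ : F.map e₁ ≫ x = x ≫ G.map e₁) (h₂ : F.map e₂ ≫ y = y ≫ G.map e₂) :
    F.map b' ≫ x = y ≫ G.map b' := by
  calc F.map b' ≫ x = F.map b' ≫ F.map e₁ ≫ x := by rw [← F.map_comp_assoc, hb.comp_idem]
    _ = F.map b' ≫ x ≫ G.map b ≫ G.map b' := by rw [h₁, ← hb.comp_inv, G.map_comp]
    _ = F.map e₂ ≫ y ≫ G.map b' := by rw [← reassoc_of% h, ← F.map_comp_assoc, hb.inv_comp]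
    _ = y ≫ G.map b' := by rw [reassoc_of% h₂, ← G.map_comp, hb.idem_comp]

end Idempotents

section Convolution

variable {C : Type u} [Category.{v} C] [MonoidalCategory C] {H : C} [MonObj H] [ComonObj H]

/-- The endomorphism `x ⊗ y ↦ x₁ ⊗ f(x₂) y` of `H ⊗ H`, the common form of the left Galois morphism
and of the idempotents `Ω_σ^2`. -/
def leftGalois (f : H ⟶ H) : H ⊗ H ⟶ H ⊗ H :=
  Δ[H] ▷ H ≫ (α_ H H H).hom ≫ H ◁ (f ▷ H) ≫ H ◁ μ[H]

theorem leftGalois_comp (f g : H ⟶ H) :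
    leftGalois f ≫ leftGalois g = leftGalois (conv g f) := by
  calc leftGalois f ≫ leftGalois g
      = 𝟙 _ ⊗≫ Δ[H] ▷ H ⊗≫ (H ◁ (f ▷ H ≫ μ[H]) ≫ Δ[H] ▷ H) ⊗≫ H ◁ (g ▷ H ≫ μ[H]) ⊗≫ 𝟙 _ := by
        simp only [leftGalois]; monoidal
    _ = 𝟙 _ ⊗≫ (Δ[H] ≫ Δ[H] ▷ H) ▷ H ⊗≫ H ◁ (H ◁ (f ▷ H ≫ μ[H]) ≫ g ▷ H) ⊗≫ H ◁ μ[H]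
          ⊗≫ 𝟙 _ := by
        rw [whisker_exchange]; monoidal
    _ = 𝟙 _ ⊗≫ (Δ[H] ≫ Δ[H] ▷ H) ▷ H ⊗≫ H ◁ (g ▷ H ≫ H ◁ f) ▷ H ⊗≫
          H ◁ (H ◁ μ[H] ≫ μ[H]) ⊗≫ 𝟙 _ := by
        rw [whisker_exchange]; monoidal
    _ = leftGalois (conv g f) := by
        rw [MonObj.mul_assoc_flip, ComonObj.comul_assoc_flip]
        simp only [leftGalois, conv, MonoidalCategory.tensorHom_def]; monoidal

theorem leftGalois_eval (f : H ⟶ H) :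
    (ρ_ H).inv ≫ H ◁ η[H] ≫ leftGalois f ≫ ε[H] ▷ H ≫ (λ_ H).hom = f := by
  calc _ = 𝟙 _ ⊗≫ (H ◁ η[H] ≫ Δ[H] ▷ H) ⊗≫ H ◁ (f ▷ H ≫ μ[H]) ⊗≫ ε[H] ▷ H ⊗≫ 𝟙 _ := by
        simp only [leftGalois]; monoidal
    _ = Δ[H] ⊗≫ (H ◁ (H ◁ η[H] ≫ f ▷ H ≫ μ[H]) ≫ ε[H] ▷ H) ⊗≫ 𝟙 _ := by
        rw [whisker_exchange]; monoidal
    _ = (Δ[H] ≫ ε[H] ▷ H) ⊗≫ (H ◁ η[H] ≫ f ▷ H) ⊗≫ μ[H] := by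
        rw [whisker_exchange]; monoidal
    _ = 𝟙 _ ⊗≫ f ⊗≫ (H ◁ η[H] ≫ μ[H]) := by
        rw [whisker_exchange, ComonObj.counit_comul]; monoidal
    _ = f := by
        rw [MonObj.mul_one]; monoidal

theorem leftGalois_injective : Function.Injective (leftGalois (H := H)) := fun f g h => by
  rw [← leftGalois_eval f, h, leftGalois_eval]

theorem leftGalois_whiskerRight_comp_mul (f : H ⟶ H) :
    leftGalois f ▷ H ≫ (α_ H H H).hom ≫ H ◁ μ[H] =
      ((α_ H H H).hom ≫ H ◁ μ[H]) ≫ leftGalois f := by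
  calc _ = 𝟙 _ ⊗≫ Δ[H] ▷ H ▷ H ⊗≫ H ◁ (f ▷ H) ▷ H ⊗≫ H ◁ (μ[H] ▷ H ≫ μ[H]) ⊗≫ 𝟙 _ := by
        simp only [leftGalois]; monoidal
    _ = 𝟙 _ ⊗≫ ((Δ[H] ≫ H ◁ f) ▷ (H ⊗ H) ≫ (H ⊗ H) ◁ μ[H]) ⊗≫ H ◁ μ[H] ⊗≫ 𝟙 _ := by
        rw [MonObj.mul_assoc]; monoidal
    _ = _ := by
        rw [← whisker_exchange]; simp only [leftGalois]; monoidal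

theorem leftGalois_comp_comul (f : H ⟶ H) :
    leftGalois f ≫ Δ[H] ▷ H ≫ (α_ H H H).hom =
      (Δ[H] ▷ H ≫ (α_ H H H).hom) ≫ H ◁ leftGalois f := by
  calc _ = 𝟙 _ ⊗≫ Δ[H] ▷ H ⊗≫ (H ◁ (f ▷ H ≫ μ[H]) ≫ Δ[H] ▷ H) ⊗≫ 𝟙 _ := by
        simp only [leftGalois]; monoidal
    _ = 𝟙 _ ⊗≫ (Δ[H] ≫ Δ[H] ▷ H) ▷ H ⊗≫ H ◁ H ◁ (f ▷ H ≫ μ[H]) ⊗≫ 𝟙 _ := by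
        rw [whisker_exchange]; monoidal
    _ = _ := by
        rw [ComonObj.comul_assoc_flip]; simp only [leftGalois]; monoidal

theorem eq_leftGalois {t : H ⊗ H ⟶ H ⊗ H}
    (hl : t ▷ H ≫ (α_ H H H).hom ≫ H ◁ μ[H] = ((α_ H H H).hom ≫ H ◁ μ[H]) ≫ t)
    (hr : t ≫ Δ[H] ▷ H ≫ (α_ H H H).hom = (Δ[H] ▷ H ≫ (α_ H H H).hom) ≫ H ◁ t) :
    t = leftGalois ((ρ_ H).inv ≫ H ◁ η[H] ≫ t ≫ ε[H] ▷ H ≫ (λ_ H).hom) := by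
  symm
  calc _ = 𝟙 _ ⊗≫ (Δ[H] ⊗≫ H ◁ H ◁ η[H] ⊗≫ H ◁ t ⊗≫ H ◁ ε[H] ▷ H) ▷ H ⊗≫ H ◁ μ[H] ⊗≫ 𝟙 _ := by
        simp only [leftGalois]; monoidal
    _ = 𝟙 _ ⊗≫ (𝟙 H ⊗≫ (Δ[H] ▷ 𝟙_ C ≫ (H ⊗ H) ◁ η[H]) ⊗≫ H ◁ t ⊗≫ H ◁ ε[H] ▷ H) ▷ H
          ⊗≫ H ◁ μ[H] ⊗≫ 𝟙 _ := by
        monoidal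
    _ = 𝟙 _ ⊗≫ (𝟙 H ⊗≫ H ◁ η[H] ⊗≫ ((Δ[H] ▷ H ≫ (α_ H H H).hom) ≫ H ◁ t)
          ⊗≫ H ◁ ε[H] ▷ H) ▷ H ⊗≫ H ◁ μ[H] ⊗≫ 𝟙 _ := by
        rw [← whisker_exchange]; monoidal
    _ = 𝟙 _ ⊗≫ H ◁ η[H] ▷ H ⊗≫ t ▷ H ⊗≫ (Δ[H] ≫ H ◁ ε[H]) ▷ H ▷ H ⊗≫ H ◁ μ[H] ⊗≫ 𝟙 _ := by
        rw [← hr]; monoidal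
    _ = 𝟙 _ ⊗≫ H ◁ η[H] ▷ H ⊗≫ (t ▷ H ≫ (α_ H H H).hom ≫ H ◁ μ[H]) ⊗≫ 𝟙 _ := by
        rw [ComonObj.comul_counit]; monoidal
    _ = 𝟙 _ ⊗≫ H ◁ (η[H] ▷ H ≫ μ[H]) ⊗≫ t ⊗≫ 𝟙 _ := by
        rw [hl]; monoidal
    _ = t := by
        rw [MonObj.one_mul]; monoidal

/-- `f` is a generalized convolution inverse of the identity, relative to the elements `p` and `q`
of the convolution monoid. -/
structure IsConvInverse (p q f : H ⟶ H) : Prop where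
  id_conv : conv (𝟙 H) f = p
  conv_id : conv f (𝟙 H) = q
  conv_left : conv f p = f
  right_conv : conv q f = f

theorem isConvInverse_iff_isGenInverse_leftGalois {p q f : H ⟶ H} :
    IsConvInverse p q f ↔
      IsGenInverse (leftGalois q) (leftGalois p) (leftGalois (𝟙 H)) (leftGalois f) := by
  constructor
  · rintro ⟨h₁, h₂, h₃, h₄⟩
    constructor <;> simp only [leftGalois_comp, h₁, h₂, h₃, h₄]
  · rintro ⟨h₁, h₂, h₃, h₄⟩
    simp only [leftGalois_comp, leftGalois_injective.eq_iff] at h₁ h₂ h₃ h₄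
    exact ⟨h₂, h₁, h₃, h₄⟩

theorem exists_isGenInverse_leftGalois_iff (p q : H ⟶ H) :
    (∃ b', IsGenInverse (leftGalois q) (leftGalois p) (leftGalois (𝟙 H)) b') ↔
      ∃ f, IsConvInverse p q f := by
  simp only [isConvInverse_iff_isGenInverse_leftGalois]
  refine ⟨fun ⟨b', hb⟩ => ?_, fun ⟨f, hf⟩ => ⟨_, hf⟩⟩
  have rightLinear := hb.naturality (tensorRight H) (𝟭 C)
    (leftGalois_whiskerRight_comp_mul _) (leftGalois_whiskerRight_comp_mul _)
    (leftGalois_whiskerRight_comp_mul _)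
  have leftColinear := hb.naturality (𝟭 C) (tensorLeft H)
    (leftGalois_comp_comul _) (leftGalois_comp_comul _) (leftGalois_comp_comul _)
  exact ⟨_, eq_leftGalois rightLinear leftColinear ▸ hb⟩

theorem galoisLeft_eq_leftGalois : galoisLeft H = leftGalois (𝟙 H) := by
  simp [galoisLeft, leftGalois]

theorem conv_whiskerRight_comp_mul (f g : H ⟶ H) :
    conv f g ▷ H ≫ μ[H] = Δ[H] ▷ H ≫ (α_ H H H).hom ≫ (f ⊗ₘ (g ▷ H ≫ μ[H])) ≫ μ[H] := by
  rw [conv, comp_whiskerRight_assoc, comp_whiskerRight_assoc, MonObj.mul_assoc]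
  simp only [MonoidalCategory.tensorHom_def]
  monoidal

end Convolution

section LeftMultiplication

variable {C : Type u} [Category.{v} C] [MonoidalCategory C]

section Monoid

variable {M N L : C} [MonObj M] [MonObj N] [MonObj L]

/-- `f` is right semilinear along `φ`: `f(xy) = f(x) φ(y)`. This expresses right linearity when `φ`
is the identity and multiplicativity when `φ = f`. -/
def IsSemilinear (φ f : M ⟶ N) : Prop :=
  μ[M] ≫ f = (f ⊗ₘ φ) ≫ μ[N]

/-- Left multiplication by the element `a`. -/
def leftMul (a : 𝟙_ C ⟶ M) : M ⟶ M :=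
  (λ_ M).inv ≫ a ▷ M ≫ μ[M]

theorem isSemilinear_id (M : C) [MonObj M] : IsSemilinear (𝟙 M) (𝟙 M) := by
  simp [IsSemilinear]

theorem IsSemilinear.comp {φ f : M ⟶ N} {ψ g : N ⟶ L}
    (hf : IsSemilinear φ f) (hg : IsSemilinear ψ g) : IsSemilinear (φ ≫ ψ) (f ≫ g) := by
  rw [IsSemilinear, reassoc_of% hf, hg, tensorHom_comp_tensorHom_assoc]

theorem isSemilinear_leftMul (a : 𝟙_ C ⟶ M) : IsSemilinear (𝟙 M) (leftMul a) := by
  simp only [IsSemilinear, leftMul, tensorHom_id, comp_whiskerRight, Category.assoc,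
    MonObj.mul_assoc]
  rw [leftUnitor_inv_naturality_assoc, whisker_exchange_assoc]
  simp

theorem one_comp_leftMul (a : 𝟙_ C ⟶ M) : η[M] ≫ leftMul a = a := by
  rw [leftMul, leftUnitor_inv_naturality_assoc, whisker_exchange_assoc, MonObj.mul_one,
    rightUnitor_naturality, unitors_inv_equal, Iso.inv_hom_id_assoc]

theorem IsSemilinear.eq_comp_leftMul {φ f : M ⟶ N} (hf : IsSemilinear φ f) :
    f = φ ≫ leftMul (η[M] ≫ f) := by
  calc f = (λ_ M).inv ≫ η[M] ▷ M ≫ (f ⊗ₘ φ) ≫ μ[N] := by rw [← hf]; simp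
    _ = (λ_ M).inv ≫ 𝟙_ C ◁ φ ≫ (η[M] ≫ f) ▷ N ≫ μ[N] := by
      rw [tensorHom_def'_assoc, ← whisker_exchange_assoc, comp_whiskerRight_assoc]
    _ = φ ≫ leftMul (η[M] ≫ f) := by rw [← leftUnitor_inv_naturality_assoc, leftMul]

theorem IsSemilinear.ext {φ f g : M ⟶ N} (hf : IsSemilinear φ f) (hg : IsSemilinear φ g)
    (h : η[M] ≫ f = η[M] ≫ g) : f = g := by
  rw [hf.eq_comp_leftMul, h, ← hg.eq_comp_leftMul]

end Monoid

section Tensor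

variable [BraidedCategory C] {M N M' N' : C} [MonObj M] [MonObj N] [MonObj M'] [MonObj N']

theorem IsSemilinear.tensorHom {φ f : M ⟶ M'} {ψ g : N ⟶ N'} (hf : IsSemilinear φ f)
    (hg : IsSemilinear ψ g) : IsSemilinear (φ ⊗ₘ ψ) (f ⊗ₘ g) := by
  rw [IsSemilinear, MonObj.tensorObj.mul_def, MonObj.tensorObj.mul_def, Category.assoc,
    tensorHom_comp_tensorHom, hf, hg, ← tensorHom_comp_tensorHom, tensorμ_natural_assoc]

theorem whiskerLeft_one_whiskerRight_mul_tensor :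
    (M ⊗ N) ◁ ((λ_ N).inv ≫ η[M] ▷ N) ≫ μ[M ⊗ N] = (α_ M N N).hom ≫ M ◁ μ[N] := by
  have h : (M ⊗ N) ◁ (η[M] ▷ N) ≫ tensorμ M N M N =
      tensorμ M N (𝟙_ C) N ≫ (M ◁ η[M]) ▷ (N ⊗ N) := by
    simpa only [tensorHom_id, id_tensorHom, whiskerLeft_id, id_whiskerRight] using
      tensorμ_natural_right M N η[M] (𝟙 N)
  calc _ = (M ⊗ N) ◁ (λ_ N).inv ≫ tensorμ M N (𝟙_ C) N ≫ (M ◁ η[M] ≫ μ[M]) ▷ _ ≫ _ ◁ μ[N] := by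
        rw [MonObj.tensorObj.mul_def, whiskerLeft_comp_assoc, reassoc_of% h,
          MonoidalCategory.tensorHom_def, comp_whiskerRight_assoc]
    _ = _ := by
        rw [MonObj.mul_one, tensorμ, braiding_tensorUnit_right]
        monoidal

theorem whiskerLeft_whiskerLeft_one_mul_tensor :
    (M ⊗ N) ◁ ((ρ_ M).inv ≫ M ◁ η[N]) ≫ μ[M ⊗ N] =
      (α_ M N M).hom ≫ M ◁ (β_ N M).hom ≫ (α_ M M N).inv ≫ μ[M] ▷ N := by
  have h : (M ⊗ N) ◁ (M ◁ η[N]) ≫ tensorμ M N M N =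
      tensorμ M N M (𝟙_ C) ≫ (M ⊗ M) ◁ (N ◁ η[N]) := by
    simpa only [tensorHom_id, id_tensorHom, whiskerLeft_id, id_whiskerRight] using
      tensorμ_natural_right M N (𝟙 M) η[N]
  calc _ = (M ⊗ N) ◁ (ρ_ M).inv ≫ tensorμ M N M (𝟙_ C) ≫ _ ◁ (N ◁ η[N] ≫ μ[N]) ≫ μ[M] ▷ N := by
        rw [MonObj.tensorObj.mul_def, whiskerLeft_comp_assoc, reassoc_of% h,
          MonoidalCategory.tensorHom_def', whiskerLeft_comp_assoc]
    _ = _ := by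
        rw [MonObj.mul_one, tensorμ]
        monoidal

theorem whiskerLeft_one_comp_leftMul_tensor (a : 𝟙_ C ⟶ M ⊗ N) :
    ((ρ_ M).inv ≫ M ◁ η[N]) ≫ leftMul a =
      (λ_ M).inv ≫ a ▷ M ≫ (α_ M N M).hom ≫ M ◁ (β_ N M).hom ≫ (α_ M M N).inv ≫ μ[M] ▷ N := by
  rw [leftMul, leftUnitor_inv_naturality_assoc, whisker_exchange_assoc,
    whiskerLeft_whiskerLeft_one_mul_tensor]

theorem whiskerLeft_one_comp_leftMul_tensor_eq_braiding_inv (a : 𝟙_ C ⟶ M ⊗ N) :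
    ((ρ_ M).inv ≫ M ◁ η[N]) ≫ leftMul a =
      (ρ_ M).inv ≫ M ◁ a ≫ (α_ M M N).inv ≫ ((β_ M M).inv ≫ μ[M]) ▷ N := by
  have h := BraidedCategory.braiding_naturality_left a M
  rw [BraidedCategory.braiding_tensor_left_hom, braiding_tensorUnit_left, Category.assoc,
    ← Iso.inv_comp_eq] at h
  rw [whiskerLeft_one_comp_leftMul_tensor, ← reassoc_of% h]
  simp

theorem leftMul_tensor_whiskerRight_comp_mul (a : 𝟙_ C ⟶ M ⊗ N) :
    leftMul a ▷ N ≫ (α_ M N N).hom ≫ M ◁ μ[N] = ((α_ M N N).hom ≫ M ◁ μ[N]) ≫ leftMul a := by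
  rw [← whiskerLeft_one_whiskerRight_mul_tensor, ← whisker_exchange_assoc, Category.assoc,
    isSemilinear_leftMul, tensorHom_id]

end Tensor
end LeftMultiplication

section Prebimonoid

variable {C : Type u} [Category.{v} C] [MonoidalCategory C] [BraidedCategory C]

/-- The axioms (b1) and the braided half of (b3) of a weak bimonoid. They are stable under reversing
the tensor product. -/
structure IsComonoidalPrebimonoid (H : C) [MonObj H] [ComonObj H] : Prop where
  mul_comul : μ[H] ≫ Δ[H] = (Δ[H] ⊗ₘ Δ[H]) ≫ tensorμ H H H H ≫ (μ[H] ⊗ₘ μ[H])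
  one_comul_braid : η[H] ≫ Δ[H] ≫ Δ[H] ▷ H =
    (λ_ (𝟙_ C)).inv ≫ ((η[H] ≫ Δ[H]) ⊗ₘ (η[H] ≫ Δ[H])) ≫
      (α_ (H ⊗ H) H H).inv ≫ (α_ H H H).hom ▷ H ≫ (H ◁ ((β_ H H).inv ≫ μ[H])) ▷ H

variable {H : C} [MonObj H] [ComonObj H]

theorem IsWeakBimonoid.isComonoidalPrebimonoid (h : IsWeakBimonoid H) :
    IsComonoidalPrebimonoid H :=
  ⟨h.mul_comul, h.one_comul_braid⟩

namespace IsComonoidalPrebimonoid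

variable (h : IsComonoidalPrebimonoid H)
include h

theorem isSemilinear_comul : IsSemilinear Δ[H] Δ[H] := by
  rw [IsSemilinear, MonObj.tensorObj.mul_def, h.mul_comul]

theorem comul_comp_leftMul : Δ[H] ≫ leftMul (η[H] ≫ Δ[H]) = Δ[H] :=
  h.isSemilinear_comul.eq_comp_leftMul.symm

theorem leftMul_idem :
    leftMul (η[H] ≫ Δ[H]) ≫ leftMul (η[H] ≫ Δ[H]) = leftMul (η[H] ≫ Δ[H]) := by
  have hP := isSemilinear_leftMul (η[H] ≫ Δ[H])
  refine IsSemilinear.ext (φ := 𝟙 _) (by simpa using hP.comp hP) hP ?_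
  rw [reassoc_of% one_comp_leftMul, one_comp_leftMul, Category.assoc, h.comul_comp_leftMul]

theorem one_comul_comul : η[H] ≫ Δ[H] ≫ Δ[H] ▷ H ≫ (α_ H H H).hom =
    η[H] ≫ Δ[H] ≫ H ◁ (((ρ_ H).inv ≫ H ◁ η[H]) ≫ leftMul (η[H] ≫ Δ[H])) := by
  have hb3 := h.one_comul_braid =≫ (α_ H H H).hom
  simp only [Category.assoc] at hb3
  rw [hb3, whiskerLeft_one_comp_leftMul_tensor_eq_braiding_inv]
  simp only [MonoidalCategory.tensorHom_def]
  monoidal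

theorem leftMul_comp_comul :
    leftMul (η[H] ≫ Δ[H]) ≫ Δ[H] ▷ H ≫ (α_ H H H).hom =
      (Δ[H] ▷ H ≫ (α_ H H H).hom) ≫ H ◁ leftMul (η[H] ≫ Δ[H]) := by
  have hP := isSemilinear_leftMul (η[H] ≫ Δ[H])
  have hHP := (isSemilinear_id H).tensorHom hP
  have hα : IsSemilinear (α_ H H H).hom (α_ H H H).hom := IsMonHom.mul_hom _
  have hφ := (h.isSemilinear_comul.tensorHom (isSemilinear_id H)).comp hα
  simp only [id_tensorHom, tensorHom_id, id_whiskerRight] at hHP hφ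
  refine IsSemilinear.ext (φ := Δ[H] ▷ H ≫ (α_ H H H).hom)
    (by simpa only [Category.id_comp] using hP.comp hφ)
    (by simpa only [Category.comp_id] using hφ.comp hHP) ?_
  rw [reassoc_of% one_comp_leftMul, MonObj.tensorObj.one_def, Category.assoc, h.one_comul_comul,
    MonoidalCategory.tensorHom_def]
  simp only [Category.assoc]
  rw [whisker_exchange_assoc]
  monoidal

theorem leftGalois_piL : leftGalois (piL H) = leftMul (η[H] ≫ Δ[H]) := by
  rw [eq_leftGalois (leftMul_tensor_whiskerRight_comp_mul _) h.leftMul_comp_comul]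
  congr 1
  have eval := whiskerLeft_one_comp_leftMul_tensor (η[H] ≫ Δ[H])
  simp only [Category.assoc] at eval
  rw [reassoc_of% eval]
  simp [piL]

theorem piL_conv_piL : conv (piL H) (piL H) = piL H :=
  leftGalois_injective (by rw [← leftGalois_comp, h.leftGalois_piL, h.leftMul_idem])

theorem piL_conv_id : conv (piL H) (𝟙 H) = 𝟙 H := by
  apply leftGalois_injective
  rw [← leftGalois_comp, h.leftGalois_piL, ← galoisLeft_eq_leftGalois, galoisLeft, Category.assoc,
    ← leftMul_tensor_whiskerRight_comp_mul, ← comp_whiskerRight_assoc, h.comul_comp_leftMul]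

end IsComonoidalPrebimonoid

end Prebimonoid

section Mirror

open MonoidalOpposite

section Monoidal

variable {C : Type u} [Category.{v} C]

/-- The splitting of the mirrored idempotent with the same image. -/
def IdemSplitting.mop {X : C} {e : X ⟶ X} (S : IdemSplitting e) : IdemSplitting e.mop where
  obj := MonoidalOpposite.mop S.obj
  q := S.q.mop
  j := S.j.mop
  q_j := congrArg (·.mop) S.q_j
  j_q := congrArg (·.mop) S.j_q

variable [MonoidalCategory C] {H : C} [MonObj H] [ComonObj H]

instance comonObjMop : ComonObj (mop H) where
  counit := ε[H].mop
  comul := Δ[H].mop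
  counit_comul := Quiver.Hom.unmop_inj (by simp)
  comul_counit := Quiver.Hom.unmop_inj (by simp)
  comul_assoc := Quiver.Hom.unmop_inj (by simp)

theorem conv_mop (f g : H ⟶ H) : conv f.mop g.mop = (conv g f).mop := rfl

theorem whiskerLeft_conv_comp_mul (f g : H ⟶ H) :
    H ◁ conv f g ≫ μ[H] = H ◁ Δ[H] ≫ (α_ H H H).inv ≫ ((H ◁ f ≫ μ[H]) ⊗ₘ g) ≫ μ[H] :=
  congrArg (·.unmop) (conv_whiskerRight_comp_mul g.mop f.mop)

theorem isConvInverse_mop_iff {p q f : H ⟶ H} :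
    IsConvInverse q.mop p.mop f.mop ↔ IsConvInverse p q f := by
  constructor <;> rintro ⟨h₁, h₂, h₃, h₄⟩
  · simp only [← mop_id, conv_mop, Quiver.Hom.mop_inj.eq_iff] at h₁ h₂ h₃ h₄
    exact ⟨h₂, h₁, h₄, h₃⟩
  · constructor <;> simp only [← mop_id, conv_mop, h₁, h₂, h₃, h₄]

end Monoidal

variable {C : Type u} [Category.{v} C] [MonoidalCategory C] [BraidedCategory C]
variable {H : C} [MonObj H] [ComonObj H]

theorem piL_mop : piL (mop H) = (piR H).mop := rfl

theorem omegaL2_mop : omegaL2 (mop H) = (omegaR1 H).mop := rfl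

theorem omegaR2_mop : omegaR2 (mop H) = (omegaL1 H).mop := rfl

theorem hMor_mop (L1 : IdemSplitting (omegaL1 H)) (R1 : IdemSplitting (omegaR1 H)) :
    hMor (H := mop H) L1.mop R1.mop = (sMor L1 R1).mop := rfl

theorem tensorμ_mop (X₁ X₂ Y₁ Y₂ : C) :
    tensorμ (mop Y₂) (mop Y₁) (mop X₂) (mop X₁) = (tensorμ X₁ X₂ Y₁ Y₂).mop :=
  Quiver.Hom.unmop_inj (by simp [tensorμ])

namespace IsComonoidalPrebimonoid

variable (h : IsComonoidalPrebimonoid H)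
include h

theorem mop : IsComonoidalPrebimonoid (MonoidalOpposite.mop H) where
  mul_comul := by
    rw [tensorμ_mop]
    exact congrArg (·.mop) h.mul_comul
  one_comul_braid := Quiver.Hom.unmop_inj <| by
    have hb3 := h.one_comul_braid =≫ (α_ H H H).hom
    simp only [Category.assoc, ← ComonObj.comul_assoc] at hb3
    refine Eq.trans hb3 ?_
    change _ = (ρ_ (𝟙_ C)).inv ≫ ((η[H] ≫ Δ[H]) ⊗ₘ (η[H] ≫ Δ[H])) ≫
      (α_ H H (H ⊗ H)).hom ≫ H ◁ (α_ H H H).inv ≫ H ◁ (((β_ H H).inv ≫ μ[H]) ▷ H)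
    monoidal

theorem piR_conv_piR : conv (piR H) (piR H) = piR H :=
  Quiver.Hom.mop_inj (by rw [← conv_mop, ← piL_mop, h.mop.piL_conv_piL])

theorem id_conv_piR : conv (𝟙 H) (piR H) = 𝟙 H :=
  Quiver.Hom.mop_inj (by rw [← conv_mop, ← piL_mop, mop_id, h.mop.piL_conv_id])

theorem omegaL2_idem : omegaL2 H ≫ omegaL2 H = omegaL2 H :=
  (leftGalois_comp _ _).trans (congrArg leftGalois h.piL_conv_piL)

theorem omegaR2_idem : omegaR2 H ≫ omegaR2 H = omegaR2 H :=
  (leftGalois_comp _ _).trans (congrArg leftGalois h.piR_conv_piR)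

theorem omegaR1_idem : omegaR1 H ≫ omegaR1 H = omegaR1 H :=
  Quiver.Hom.mop_inj (by rw [mop_comp, ← omegaL2_mop, h.mop.omegaL2_idem])

theorem omegaL1_idem : omegaL1 H ≫ omegaL1 H = omegaL1 H :=
  Quiver.Hom.mop_inj (by rw [mop_comp, ← omegaR2_mop, h.mop.omegaR2_idem])

end IsComonoidalPrebimonoid

end Mirror

section Antipode

variable {C : Type u} [Category.{v} C] [MonoidalCategory C] [BraidedCategory C]
variable {H : C} [MonObj H] [ComonObj H]

theorem isAntipode_iff_isConvInverse (s : H ⟶ H) :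
    IsAntipode H s ↔ IsConvInverse (piL H) (piR H) s where
  mp h := ⟨h.id_conv, h.conv_id, h.conv_piL, h.piR_conv⟩
  mpr h :=
    { id_conv := h.id_conv
      conv_id := h.conv_id
      conv_piL := h.conv_left
      piR_conv := h.right_conv
      left_piR := by simp [← h.conv_id, conv_whiskerRight_comp_mul]
      left_piL := by simp [← h.id_conv, conv_whiskerRight_comp_mul]
      right_piL := by simp [← h.id_conv, whiskerLeft_conv_comp_mul]
      right_piR := by simp [← h.conv_id, whiskerLeft_conv_comp_mul] }

theorem IsWeakBimonoid.isWeakHopfAlgebra_iff (h : IsWeakBimonoid H) :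
    IsWeakHopfAlgebra H ↔ ∃ s, IsAntipode H s :=
  ⟨fun hs => hs.exists_antipode, fun hs => ⟨h, hs⟩⟩

namespace IsComonoidalPrebimonoid

variable (h : IsComonoidalPrebimonoid H)
include h

theorem isIso_hMor_iff (R2 : IdemSplitting (omegaR2 H)) (L2 : IdemSplitting (omegaL2 H)) :
    IsIso (hMor R2 L2) ↔ ∃ s, IsConvInverse (piL H) (piR H) s := by
  rw [← exists_isGenInverse_leftGalois_iff, hMor, galoisLeft_eq_leftGalois]
  refine isIso_iff_exists_isGenInverse R2 L2 ?_ ?_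
  · exact (leftGalois_comp _ _).trans (congrArg leftGalois h.id_conv_piR)
  · exact (leftGalois_comp _ _).trans (congrArg leftGalois h.piL_conv_id)

theorem isIso_sMor_iff (L1 : IdemSplitting (omegaL1 H)) (R1 : IdemSplitting (omegaR1 H)) :
    IsIso (sMor L1 R1) ↔ ∃ s, IsConvInverse (piL H) (piR H) s := by
  have isIso_iff : IsIso (sMor L1 R1).mop ↔ IsIso (sMor L1 R1) :=
    ⟨fun _ => inferInstanceAs (IsIso (sMor L1 R1).mop.unmop), fun _ => inferInstance⟩
  rw [← isIso_iff, ← hMor_mop]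
  exact (h.mop.isIso_hMor_iff L1.mop R1.mop).trans
    ⟨fun ⟨s, hs⟩ => ⟨s.unmop, isConvInverse_mop_iff.1 hs⟩,
      fun ⟨s, hs⟩ => ⟨s.mop, isConvInverse_mop_iff.2 hs⟩⟩

end IsComonoidalPrebimonoid

end Antipode

end WeakHopf

theorem mainTheorem5_general {C : Type u} [Category.{v} C] [MonoidalCategory C]
    [BraidedCategory C] [IsIdempotentComplete C] (H : C) [MonObj H] [ComonObj H]
    (hH : WeakHopf.IsComonoidalPrebimonoid H) :
    (Nonempty (WeakHopf.IdemSplitting (WeakHopf.omegaL1 H)) ∧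
      Nonempty (WeakHopf.IdemSplitting (WeakHopf.omegaR1 H)) ∧
      Nonempty (WeakHopf.IdemSplitting (WeakHopf.omegaL2 H)) ∧
      Nonempty (WeakHopf.IdemSplitting (WeakHopf.omegaR2 H))) ∧
    ∀ (L1 : WeakHopf.IdemSplitting (WeakHopf.omegaL1 H))
      (R1 : WeakHopf.IdemSplitting (WeakHopf.omegaR1 H))
      (L2 : WeakHopf.IdemSplitting (WeakHopf.omegaL2 H))
      (R2 : WeakHopf.IdemSplitting (WeakHopf.omegaR2 H)),
      List.TFAE [∃ s : H ⟶ H, WeakHopf.IsAntipode H s,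
        IsIso (WeakHopf.hMor R2 L2),
        IsIso (WeakHopf.sMor L1 R1)] := by
  refine ⟨⟨WeakHopf.IdemSplitting.nonempty_of_idem hH.omegaL1_idem,
    WeakHopf.IdemSplitting.nonempty_of_idem hH.omegaR1_idem,
    WeakHopf.IdemSplitting.nonempty_of_idem hH.omegaL2_idem,
    WeakHopf.IdemSplitting.nonempty_of_idem hH.omegaR2_idem⟩,
    fun L1 R1 L2 R2 => ?_⟩
  simp only [WeakHopf.isAntipode_iff_isConvInverse]
  tfae_have 2 ↔ 1 := hH.isIso_hMor_iff R2 L2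
  tfae_have 3 ↔ 1 := hH.isIso_sMor_iff L1 R1
  tfae_finish

theorem mainTheorem5 {C : Type u} [Category.{v} C] [MonoidalCategory C] [BraidedCategory C]
    [Limits.HasEqualizers C] [Limits.HasCoequalizers C]
    (H : C) [MonObj H] [ComonObj H] (hH : WeakHopf.IsWeakBimonoid H) :
    (Nonempty (WeakHopf.IdemSplitting (WeakHopf.omegaL1 H)) ∧
      Nonempty (WeakHopf.IdemSplitting (WeakHopf.omegaR1 H)) ∧
      Nonempty (WeakHopf.IdemSplitting (WeakHopf.omegaL2 H)) ∧
      Nonempty (WeakHopf.IdemSplitting (WeakHopf.omegaR2 H))) ∧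
    ∀ (L1 : WeakHopf.IdemSplitting (WeakHopf.omegaL1 H))
      (R1 : WeakHopf.IdemSplitting (WeakHopf.omegaR1 H))
      (L2 : WeakHopf.IdemSplitting (WeakHopf.omegaL2 H))
      (R2 : WeakHopf.IdemSplitting (WeakHopf.omegaR2 H)),
      List.TFAE [WeakHopf.IsWeakHopfAlgebra H,
        IsIso (WeakHopf.hMor R2 L2),
        IsIso (WeakHopf.sMor L1 R1)] := by
  have := (Idempotents.isIdempotentComplete_iff_hasEqualizer_of_id_and_idempotent C).2
    fun _ _ _ => inferInstance
  rw [hH.isWeakHopfAlgebra_iff]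
  exact mainTheorem5_general H hH.isComonoidalPrebimonoid
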